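/- Let $p$ be a prime, $a\ge 1$, $r,\ell\ge 0$ integers, let $P,Q_1,\dots,Q_\ell$ be Laurent polynomials in $r$ variables with integer coefficients, let $k_1,\dots,k_\ell$ be non-negative integers, let $X$ be a set and $F:(\mathbb{Z}/p^a\mathbb{Z})^\ell\to X$ an arbitrary function. Write $\mathrm{ct}[\cdot]$ for the constant term of a Laurent polynomial, and for $n\in\mathbb{N}=\{0,1,2,\dots\}$ put $$b_n = F\bigl(\mathrm{ct}[P^{n+k_1}Q_1]\bmod p^a,\ \dots,\ \mathrm{ct}[P^{n+k_\ell}Q_\ell]\bmod p^a\bigr).$$ Call a sequence linearly recurrent if there is a constant $C$ such that for every nonempty word $w$ of length $|w|$, every occurrence of $w$ as a block of consecutive terms of the sequence is followed by another occurrence of $w$ starting at most $C|w|$ (and at least one) positions later. 1. The sequence $(b_n)_{n\in\mathbb{N}}$ is linearly recurrent if and only if either $p\nmid \mathrm{ct}[P^n]$ for all $n\in\mathbb{N}$, or $b_n=F(0,\dots,0)$ for all $n\in\mathbb{N}$. In particular, if $(b_n)$ is not the constant sequence with value $F(0,\dots,0)$, then it is linearly recurrent if and only if $p\nmid \mathrm{ct}[P^n]$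 for all $n\in\mathbb{N}$. 2. If $p\mid \mathrm{ct}[P^n]$ for some $n\in\mathbb{N}$, then $F(0,\dots,0)$ has frequency $1$ in $(b_n)$, i.e. $\lim_{N\to\infty}\frac1N\,\#\{0\le n<N : b_n=F(0,\dots,0)\}=1$. -/

import Mathlib

/-- Laurent polynomials with integer coefficients in `r` variables: the group ring over `ℤ` of the
group `ℤ ^ r` of exponent vectors. -/
abbrev IntLaurent (r : ℕ) : Type := AddMonoidAlgebra ℤ (Fin r → ℤ)

/-- The constant term of a Laurent polynomial. -/
def constTerm {r : ℕ} (P : IntLaurent r) : ℤ := P.coeff 0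

/-- The word `w` occurs in the sequence `s` at position `i`. -/
def OccursAt {X : Type*} (s : ℕ → X) (w : List X) (i : ℕ) : Prop :=
  ∀ (t : ℕ) (ht : t < w.length), s (i + t) = w[t]

/-- Every occurrence of `w` in `s` is followed by another one at distance at most `C`. -/
def RecursWithin {X : Type*} (s : ℕ → X) (w : List X) (C : ℕ) : Prop :=
  ∀ i : ℕ, OccursAt s w i → ∃ j : ℕ, 1 ≤ j ∧ j ≤ C ∧ OccursAt s w (i + j)

/-- A sequence is linearly recurrent if every nonempty word occurring in it recurs with gaps
bounded by a fixed multiple of its length. (A word that does not occur satisfies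
`RecursWithin` vacuously.) -/
def IsLinearlyRecurrent {X : Type*} (s : ℕ → X) : Prop :=
  ∃ C : ℕ, ∀ w : List X, w ≠ [] → RecursWithin s w (C * w.length)

/-- The value `c` has frequency `d` in `s`: the set of indices `n` with `s n = c` has
asymptotic density `d`. -/
def HasFrequency {X : Type*} (s : ℕ → X) (c : X) (d : ℝ) : Prop :=
  Filter.Tendsto (fun N : ℕ => (Set.ncard {n : ℕ | n < N ∧ s n = c} : ℝ) / (N : ℝ))
    Filter.atTop (nhds d)

/-- The sequence `b n = F (ct (P ^ (n + k₁) * Q₁) mod M, …, ct (P ^ (n + k_ℓ) * Q_ℓ) mod M)`. -/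
noncomputable def combinedSeq {r l M : ℕ} {X : Type*} (F : (Fin l → ZMod M) → X) (P : IntLaurent r)
    (Q : Fin l → IntLaurent r) (k : Fin l → ℕ) (n : ℕ) : X :=
  F fun i => (constTerm (P ^ (n + k i) * Q i) : ZMod M)

/-! Write c(q) = ct[P^(p^(a-1) q)] mod p^a. By Frobenius, P^(p^(a-1) p^s q) agrees mod p^a with
P^(p^(a-1) q) after x ↦ x^(p^s). So the block of length p^(a-1) p^s at position p^(a-1) p^s q
depends only on the state of q: the coefficients mod p^a of P^(p^(a-1) q) in a cube independent of s
(`combinedSeq_block`). For L large, the state of p^L m + x is c(m) times the state of x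
(`boxResidues_pow`).

If p divides no ct[P^n], then c takes unit values and hits 1 with bounded gaps
(`exists_gap_eq_one`). Pairs of consecutive states then recur with bounded gaps, and this at every
scale s is linear recurrence (`isLinearlyRecurrent_of_states`).

If p divides some ct[P^n], multiplicativity yields y with c(y) = 0. A certain digit in a large base,
anywhere in n, then makes a state vanish and forces the value F(0); almost every n contains it
(`hasFrequency_one_of_digit`). A linearly recurrent sequence with a value of frequency 1 is
constant, which gives the remaining implication. -/

namespace IntLaurent

/-! ### Dilation and Frobenius congruences -/

/-- The substitution `x ↦ x ^ N` on Laurent polynomials. -/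
noncomputable def dilate {r : ℕ} (N : ℕ) : IntLaurent r →+* IntLaurent r :=
  AddMonoidAlgebra.mapDomainRingHom ℤ (nsmulAddMonoidHom N : (Fin r → ℤ) →+ (Fin r → ℤ))

@[simp]
lemma dilate_single {r : ℕ} (N : ℕ) (e : Fin r → ℤ) (c : ℤ) :
    dilate N (AddMonoidAlgebra.single e c) = AddMonoidAlgebra.single (N • e) c := by
  simp [dilate]

lemma dilate_dilate {r : ℕ} (M N : ℕ) (f : IntLaurent r) :
    dilate M (dilate N f) = dilate (M * N) f := by
  induction f using AddMonoidAlgebra.induction_linear with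
  | zero => simp
  | add x y hx hy => simp [hx, hy]
  | single e c => simp [mul_smul]

lemma dilate_one {r : ℕ} (f : IntLaurent r) : dilate 1 f = f := by
  induction f using AddMonoidAlgebra.induction_linear with
  | zero => simp
  | add x y hx hy => simp [hx, hy]
  | single e c => simp

/-- Coefficients of a product one of whose factors is dilated. -/
lemma coeff_dilate_mul {r : ℕ} (N : ℕ) (f g : IntLaurent r) (x : Fin r → ℤ) :
    (dilate N f * g).coeff x = f.coeff.sum fun e c => c * g.coeff (x - N • e) := by
  induction f using AddMonoidAlgebra.induction_linear with
  | zero => simp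
  | add f₁ f₂ h₁ h₂ =>
    rw [map_add, add_mul, AddMonoidAlgebra.coeff_add, Finsupp.add_apply, h₁, h₂,
      AddMonoidAlgebra.coeff_add, Finsupp.sum_add_index'] <;> simp [add_mul]
  | single e c =>
    have h := AddMonoidAlgebra.coeff_single_mul_add g c (N • e) (x - N • e)
    rw [add_sub_cancel] at h
    rw [dilate_single, h, AddMonoidAlgebra.coeff_single, Finsupp.sum_single_index]
    simp

lemma dvd_coeff_of_natCast_dvd {r : ℕ} {n : ℕ} {f : IntLaurent r} (h : (n : IntLaurent r) ∣ f)
    (e : Fin r → ℤ) : (n : ℤ) ∣ f.coeff e := by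
  obtain ⟨g, rfl⟩ := h
  rw [← nsmul_eq_mul, AddMonoidAlgebra.coeff_smul_apply, nsmul_eq_mul]
  exact Dvd.intro _ rfl

lemma coeff_cast_eq_of_natCast_dvd_sub {r : ℕ} {n : ℕ} {f g : IntLaurent r}
    (h : (n : IntLaurent r) ∣ f - g) (e : Fin r → ℤ) :
    (f.coeff e : ZMod n) = (g.coeff e : ZMod n) := by
  rw [← sub_eq_zero, ← Int.cast_sub, ZMod.intCast_zmod_eq_zero_iff_dvd]
  exact dvd_coeff_of_natCast_dvd h e

/-- The Frobenius congruence for Laurent polynomials. -/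
lemma prime_dvd_pow_sub_dilate {r p : ℕ} (hp : p.Prime) (f : IntLaurent r) :
    (p : IntLaurent r) ∣ f ^ p - dilate p f := by
  induction f using AddMonoidAlgebra.induction_linear with
  | zero => simp [hp.ne_zero]
  | add x y hx hy =>
    obtain ⟨c, hc⟩ := exists_add_pow_prime_eq hp x y
    rw [hc, map_add]
    have : x ^ p + y ^ p + p * x * y * c - (dilate p x + dilate p y)
        = (x ^ p - dilate p x) + (y ^ p - dilate p y) + p * (x * y * c) := by ring
    rw [this]
    exact dvd_add (dvd_add hx hy) (Dvd.intro _ rfl)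
  | single e c =>
    have := Fact.mk hp
    obtain ⟨d, hd⟩ : (p : ℤ) ∣ c ^ p - c := by
      rw [← ZMod.intCast_zmod_eq_zero_iff_dvd]
      simp
    refine ⟨AddMonoidAlgebra.single (p • e) d, ?_⟩
    rw [AddMonoidAlgebra.single_pow, dilate_single, ← AddMonoidAlgebra.single_sub, hd,
      ← nsmul_eq_mul p (AddMonoidAlgebra.single (p • e) d), AddMonoidAlgebra.smul_single,
      nsmul_eq_mul p d]

lemma prime_dvd_pow_pow_sub_dilate {r p : ℕ} (hp : p.Prime) (f : IntLaurent r) (s : ℕ) :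
    (p : IntLaurent r) ∣ f ^ p ^ s - dilate (p ^ s) f := by
  induction s with
  | zero => simp [dilate_one]
  | succ s ih =>
    have h := prime_dvd_pow_sub_dilate hp (dilate (p ^ s) f)
    rw [dilate_dilate, ← pow_succ'] at h
    have h' : (p : IntLaurent r) ∣ (f ^ p ^ s) ^ p - (dilate (p ^ s) f) ^ p :=
      ih.trans (sub_dvd_pow_sub_pow _ _ _)
    rw [← pow_mul, ← pow_succ] at h'
    simpa using dvd_add h' h

/-- Each p-th power lifts a congruence mod p^j to one mod p^(j+1); the a - 1 lifts from p to p^a are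
the source of the factor p^(a-1) in all exponents. -/
lemma prime_pow_dvd_pow_sub_dilate {r p a : ℕ} (hp : p.Prime) (ha : 1 ≤ a) (f : IntLaurent r)
    (s q : ℕ) :
    ((p ^ a : ℕ) : IntLaurent r) ∣
      f ^ (p ^ (a - 1) * p ^ s * q) - dilate (p ^ s) (f ^ (p ^ (a - 1) * q)) := by
  have h := dvd_sub_pow_of_dvd_sub (prime_dvd_pow_pow_sub_dilate hp f s) (a - 1)
  rw [Nat.sub_add_cancel ha] at h
  have h' := h.trans (sub_dvd_pow_sub_pow _ _ q)
  rw [← pow_mul, ← pow_mul, ← pow_mul, ← map_pow] at h'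
  rw [Nat.cast_pow]
  convert h' using 3
  ring

/-! ### Supports and coefficients near the origin -/

/-- All exponents of `f` lie in the cube of side `2 * B` centred at the origin. -/
def SupportedIn {r : ℕ} (f : IntLaurent r) (B : ℕ) : Prop :=
  ∀ e, f.coeff e ≠ 0 → ∀ i, |e i| ≤ B

lemma SupportedIn.mono {r : ℕ} {f : IntLaurent r} {B B' : ℕ} (h : SupportedIn f B)
    (hB : B ≤ B') : SupportedIn f B' :=
  fun e he i => (h e he i).trans (by exact_mod_cast hB)

lemma exists_supportedIn {r : ℕ} (f : IntLaurent r) : ∃ B, SupportedIn f B := by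
  refine ⟨f.coeff.support.sup fun e => Finset.univ.sup fun i => (e i).natAbs, fun e he i => ?_⟩
  rw [Int.abs_eq_natAbs]
  have h₁ : (e i).natAbs ≤ Finset.univ.sup fun i => (e i).natAbs :=
    Finset.le_sup (f := fun i => (e i).natAbs) (Finset.mem_univ i)
  have h₂ := Finset.le_sup (f := fun e : Fin r → ℤ => Finset.univ.sup fun i => (e i).natAbs)
    (Finsupp.mem_support_iff.2 he)
  exact_mod_cast h₁.trans h₂

lemma supportedIn_one {r : ℕ} : SupportedIn (1 : IntLaurent r) 0 := by
  intro e he i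
  by_cases h : e = 0
  · simp [h]
  · simp [AddMonoidAlgebra.one_def, Ne.symm h] at he

lemma SupportedIn.mul {r : ℕ} {f g : IntLaurent r} {B B' : ℕ} (hf : SupportedIn f B)
    (hg : SupportedIn g B') : SupportedIn (f * g) (B + B') := by
  intro e he i
  rw [← dilate_one f, coeff_dilate_mul] at he
  obtain ⟨x, hx, hne⟩ := Finset.exists_ne_zero_of_sum_ne_zero he
  have h₁ := hf x (Finsupp.mem_support_iff.1 hx) i
  have h₂ := hg _ (right_ne_zero_of_mul hne) i
  have : e i = x i + (e - 1 • x) i := by simp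
  rw [this]
  push_cast
  exact (abs_add_le _ _).trans (add_le_add h₁ h₂)

lemma SupportedIn.pow {r : ℕ} {f : IntLaurent r} {B : ℕ} (hf : SupportedIn f B) (n : ℕ) :
    SupportedIn (f ^ n) (n * B) := by
  induction n with
  | zero => simpa using supportedIn_one
  | succ n ih =>
    rw [pow_succ, Nat.succ_mul]
    exact ih.mul hf

/-- The constant term of `f (x ^ N) * g` depends only on the coefficients of `f` in a cube. -/
lemma constTerm_dilate_mul_congr {r M N B : ℕ} (hN : 0 < N) {f f' g : IntLaurent r}
    (hg : SupportedIn g (N * B))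
    (h : ∀ e : Fin r → ℤ, (∀ i, |e i| ≤ B) → (f.coeff e : ZMod M) = f'.coeff e) :
    (constTerm (dilate N f * g) : ZMod M) = constTerm (dilate N f' * g) := by
  have key : (constTerm (dilate N (f - f') * g) : ZMod M) = 0 := by
    rw [constTerm, coeff_dilate_mul, Finsupp.sum, Int.cast_sum]
    refine Finset.sum_eq_zero fun e _ => ?_
    rw [Int.cast_mul]
    by_cases hge : g.coeff (0 - N • e) = 0
    · rw [hge, Int.cast_zero, mul_zero]
    · have he : ∀ i, |e i| ≤ B := by
        intro i
        have := hg _ hge i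
        rw [zero_sub, Pi.neg_apply, Pi.smul_apply, nsmul_eq_mul, abs_neg, abs_mul,
          Nat.abs_cast, Nat.cast_mul] at this
        exact le_of_mul_le_mul_left this (Nat.cast_pos.2 hN)
      simp [h e he]
  rw [map_sub, sub_mul] at key
  simpa [constTerm, sub_eq_zero] using key

/-- If `N` is large, coefficients of `f (x ^ N) * g` near the origin factor. -/
lemma coeff_dilate_mul_of_lt {r N B D : ℕ} {f g : IntLaurent r} (hg : SupportedIn g D)
    (hN : B + D < N) {x : Fin r → ℤ} (hx : ∀ i, |x i| ≤ B) :
    (dilate N f * g).coeff x = constTerm f * g.coeff x := by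
  rw [coeff_dilate_mul, Finsupp.sum, Finset.sum_eq_single 0]
  · simp [constTerm]
  · intro e _ he
    obtain ⟨i, hi⟩ := Function.ne_iff.1 he
    by_contra hne
    have h₁ := hg _ (right_ne_zero_of_mul hne) i
    rw [Pi.sub_apply, Pi.smul_apply, nsmul_eq_mul] at h₁
    -- A nonzero exponent is dilated to distance at least N > B + D, too far for the support of g to
    -- bring it back into the cube.
    have h₂ : (N : ℤ) ≤ |(N : ℤ) * e i| := by
      rw [abs_mul, Nat.abs_cast]
      exact le_mul_of_one_le_right (by positivity) (Int.one_le_abs hi)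
    have h₃ : |(N : ℤ) * e i| ≤ |x i| + |x i - N * e i| := by
      have := abs_sub (x i) (x i - N * e i)
      rwa [sub_sub_cancel] at this
    have h₄ := hx i
    have : ((B + D : ℕ) : ℤ) < N := by exact_mod_cast hN
    push_cast at this
    linarith
  · intro h
    simp [Finsupp.notMem_support_iff.1 h]

/-- The residues modulo `M` of the coefficients of `f` in a cube. -/
def boxResidues {r : ℕ} (M B : ℕ) (f : IntLaurent r) :
    {e : Fin r → ℤ // ∀ i, |e i| ≤ B} → ZMod M :=
  fun e => f.coeff e

instance finite_box {r B : ℕ} : Finite {e : Fin r → ℤ // ∀ i, |e i| ≤ B} := by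
  refine Set.Finite.to_subtype (s := {e : Fin r → ℤ | ∀ i, |e i| ≤ B})
    ((Set.finite_Icc (fun _ => -(B : ℤ)) (fun _ => (B : ℤ))).subset fun e he => ?_)
  exact ⟨fun i => (abs_le.1 (he i)).1, fun i => (abs_le.1 (he i)).2⟩

end IntLaurent

open IntLaurent

/-! ### States: residues of coefficients in a cube -/

lemma constTerm_pow_mul_congr {r p a B s t q : ℕ} (hp : p.Prime) (ha : 1 ≤ a)
    {P Q : IntLaurent r} {f : IntLaurent r} (hQ : SupportedIn (P ^ t * Q) (p ^ s * B))
    (h : boxResidues (p ^ a) B (P ^ (p ^ (a - 1) * q)) = boxResidues (p ^ a) B f) :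
    (constTerm (P ^ (p ^ (a - 1) * p ^ s * q + t) * Q) : ZMod (p ^ a)) =
      constTerm (dilate (p ^ s) f * (P ^ t * Q)) := by
  rw [pow_add, mul_assoc]
  refine Eq.trans ?_ (constTerm_dilate_mul_congr (pow_pos hp.pos s) hQ
    (f := P ^ (p ^ (a - 1) * q)) fun e he => congrFun h ⟨e, he⟩)
  refine coeff_cast_eq_of_natCast_dvd_sub ?_ 0
  rw [← sub_mul]
  exact (prime_pow_dvd_pow_sub_dilate hp ha P s q).mul_right _

lemma boxResidues_pow {r p a B D L m x : ℕ} (hp : p.Prime) (ha : 1 ≤ a) {P : IntLaurent r}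
    (hD : SupportedIn (P ^ (p ^ (a - 1) * x)) D) (hL : B + D < p ^ L) :
    boxResidues (p ^ a) B (P ^ (p ^ (a - 1) * (p ^ L * m + x))) =
      (constTerm (P ^ (p ^ (a - 1) * m)) : ZMod (p ^ a)) •
        boxResidues (p ^ a) B (P ^ (p ^ (a - 1) * x)) := by
  funext e
  rw [mul_add, ← mul_assoc, pow_add, Pi.smul_apply, smul_eq_mul]
  simp only [boxResidues]
  rw [← Int.cast_mul, ← coeff_dilate_mul_of_lt hD hL e.2]
  refine coeff_cast_eq_of_natCast_dvd_sub ?_ e.1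
  rw [← sub_mul]
  exact (prime_pow_dvd_pow_sub_dilate hp ha P L m).mul_right _

/-- Dilation preserves the constant term. This moves a vanishing mod p to an exponent divisible by
p^(a-1), where c is defined. -/
lemma prime_dvd_constTerm_pow {r p s n : ℕ} (hp : p.Prime) {P : IntLaurent r}
    (h : (p : ℤ) ∣ constTerm (P ^ n)) : (p : ℤ) ∣ constTerm (P ^ (p ^ s * n)) := by
  have h₁ := dvd_coeff_of_natCast_dvd (prime_dvd_pow_pow_sub_dilate hp (P ^ n) s) 0
  have h₂ : (dilate (p ^ s) (P ^ n)).coeff 0 = constTerm (P ^ n) := by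
    have h₃ := coeff_dilate_mul (p ^ s) (P ^ n) 1 0
    rw [mul_one] at h₃
    rw [h₃, Finsupp.sum, Finset.sum_eq_single 0]
    · simp [constTerm]
    · intro e _ he
      have : (0 : Fin r → ℤ) ≠ 0 - p ^ s • e := by
        rw [zero_sub, ne_comm, neg_ne_zero]
        exact smul_ne_zero (pow_ne_zero _ hp.ne_zero) he
      rw [AddMonoidAlgebra.one_def, AddMonoidAlgebra.coeff_single,
        Finsupp.single_eq_of_ne this.symm, mul_zero]
    · intro h
      simp [Finsupp.notMem_support_iff.1 h]
  rw [AddMonoidAlgebra.coeff_sub, Finsupp.sub_apply, h₂, ← pow_mul, mul_comm n] at h₁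
  exact (dvd_sub_left h).1 h₁

/-! ### Recurrence from states -/

/-- A sequence whose blocks of length `T * p ^ s` are governed by a sequence of states, consecutive
pairs of which recur with bounded gaps, is linearly recurrent. -/
lemma isLinearlyRecurrent_of_states {X S : Type*} {b : ℕ → X} {v : ℕ → S} {p T : ℕ} (hp : 1 < p)
    (hT : 0 < T)
    (hb : ∀ q q' s t, t < T * p ^ s → v q = v q' → b (T * p ^ s * q + t) = b (T * p ^ s * q' + t))
    (hv : ∃ G, ∀ x, ∃ q, x < q ∧ q ≤ x + G ∧ v q = v x ∧ v (q + 1) = v (x + 1)) :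
    IsLinearlyRecurrent b := by
  obtain ⟨G, hG⟩ := hv
  refine ⟨T * p * G, fun w hw i hi => ?_⟩
  have hn : w.length ≠ 0 := by simpa using hw
  set n := w.length with hn_def
  obtain ⟨s, hs₁, hs₂⟩ : ∃ s, n ≤ p ^ s ∧ p ^ s ≤ p * n :=
    ⟨Nat.log p n + 1, (Nat.lt_pow_succ_log_self hp n).le, by
      rw [pow_succ']; exact Nat.mul_le_mul_left _ (Nat.pow_log_le_self p hn)⟩
  set N := T * p ^ s with hN
  have hN0 : 0 < N := by positivity
  have hnN : n ≤ N := hs₁.trans (Nat.le_mul_of_pos_left _ hT)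
  obtain ⟨q, hxq, hqG, hq₁, hq₂⟩ := hG (i / N)
  obtain ⟨d, rfl⟩ := Nat.exists_eq_add_of_lt hxq
  refine ⟨N * (d + 1), Nat.one_le_iff_ne_zero.2 (by positivity), ?_, fun t ht => ?_⟩
  · calc N * (d + 1) ≤ T * (p * n) * G :=
          Nat.mul_le_mul (Nat.mul_le_mul_left _ hs₂) (by omega)
      _ = T * p * G * n := by ring
  · rw [← hi t ht]
    have hi' := Nat.div_add_mod i N
    have hlt := Nat.mod_lt i hN0
    set x := i / N
    -- Since the word has length at most N, it meets only blocks x and x + 1; hence the need for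
    -- pairs of states.
    by_cases h : i % N + t < N
    · have := hb _ _ s (i % N + t) h hq₁
      rw [← hN] at this
      convert this using 2
      · rw [← hi']; simp; ring
      · omega
    · obtain ⟨u, hu⟩ : ∃ u, i % N + t = N + u := ⟨i % N + t - N, by omega⟩
      have := hb _ _ s u (by omega) hq₂
      rw [← hN] at this
      convert this using 2
      · calc i + N * (d + 1) + t = N * x + (i % N + t) + N * (d + 1) := by omega
          _ = _ := by rw [hu]; ring
      · calc i + t = N * x + (i % N + t) := by omega
          _ = _ := by rw [hu]; ring

/-- For a sequence with finitely many values, recurrence with gaps bounded separately for each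
value can be made uniform. -/
lemma exists_uniform_gap {S : Type*} [Finite S] {f : ℕ → S}
    (h : ∀ x, ∃ G, ∀ z, ∃ q, z < q ∧ q ≤ z + G ∧ f q = f x) :
    ∃ G, ∀ x, ∃ q, x < q ∧ q ≤ x + G ∧ f q = f x := by
  have h' : ∀ σ : S, ∃ G, ∀ x, f x = σ → ∀ z, ∃ q, z < q ∧ q ≤ z + G ∧ f q = f x := by
    intro σ
    by_cases hσ : ∃ x, f x = σ
    · obtain ⟨x, rfl⟩ := hσ
      obtain ⟨G, hG⟩ := h x
      exact ⟨G, fun y hy => by simpa only [hy] using hG⟩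
    · exact ⟨0, fun x hx => absurd ⟨x, hx⟩ hσ⟩
  choose G hG using h'
  obtain ⟨K, hK⟩ := (Set.finite_range G).bddAbove
  refine ⟨K, fun x => ?_⟩
  obtain ⟨q, h₁, h₂, h₃⟩ := hG (f x) x rfl x
  exact ⟨q, h₁, h₂.trans (by have := hK (Set.mem_range_self (f x)); omega), h₃⟩

/-- Concatenate n copies of the base-p expansion of x, padded with enough zeros. -/
lemma exists_eq_pow_of_mul {R : Type*} [CommMonoid R] {c : ℕ → R} {p : ℕ} (h0 : c 0 = 1)
    (hc : ∀ x, ∃ L₀, ∀ L, L₀ ≤ L → ∀ m, c (p ^ L * m + x) = c m * c x) (x n : ℕ) :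
    ∃ y, c y = c x ^ n := by
  induction n with
  | zero => exact ⟨0, by simpa using h0⟩
  | succ n ih =>
    obtain ⟨y, hy⟩ := ih
    obtain ⟨L, hL⟩ := hc x
    exact ⟨p ^ L * y + x, by rw [hL L le_rfl, hy, pow_succ]⟩

/-- A unit-valued sequence that is multiplicative under separated concatenation of digits takes
the value `1` with bounded gaps. -/
lemma exists_gap_eq_one {R : Type*} [CommMonoid R] [Finite R] {c : ℕ → R} {p : ℕ} (hp : 1 < p)
    (h0 : c 0 = 1) (hu : ∀ n, IsUnit (c n))
    (hc : ∀ x, ∃ L₀, ∀ L, L₀ ≤ L → ∀ m, c (p ^ L * m + x) = c m * c x) :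
    ∃ G, ∀ z, ∃ q, z < q ∧ q ≤ z + G ∧ c q = 1 := by
  have hinv : ∀ g : R, ∃ y, ∀ m, c m = g → c m * c y = 1 := by
    intro g
    by_cases hg : ∃ x, c x = g
    · obtain ⟨x, rfl⟩ := hg
      obtain ⟨u, hux⟩ := hu x
      -- With n the order of c x, the power n - 1 is its inverse and is again a value of c.
      obtain ⟨n, hn, hpow⟩ := (isOfFinOrder_of_finite u).exists_pow_eq_one
      obtain ⟨y, hy⟩ := exists_eq_pow_of_mul h0 hc x (n - 1)
      refine ⟨y, fun m hm => ?_⟩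
      rw [hm, hy, ← pow_succ', Nat.sub_add_cancel hn, ← hux, ← Units.val_pow_eq_pow_val, hpow,
        Units.val_one]
    · exact ⟨0, fun m hm => absurd ⟨m, hm⟩ hg⟩
  choose Y hY using hinv
  choose L₀ hL₀ using hc
  obtain ⟨K, hK⟩ := (Set.finite_range fun g => max (Y g) (L₀ (Y g))).bddAbove
  have hK' : ∀ g, Y g ≤ K ∧ L₀ (Y g) ≤ K := fun g => max_le_iff.1 (hK (Set.mem_range_self g))
  -- Go to the next multiple p^K m of p^K beyond z, then write into the low K digits a y with c y
  -- inverse to c m.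
  refine ⟨2 * p ^ K, fun z => ?_⟩
  set m := z / p ^ K + 1 with hm
  have hpos : 0 < p ^ K := by positivity
  have hlt : Y (c m) < p ^ K := (hK' _).1.trans_lt (Nat.lt_pow_self hp)
  have h₁ := Nat.div_add_mod z (p ^ K)
  have h₂ := Nat.mod_lt z hpos
  have h₄ := Nat.mul_div_le z (p ^ K)
  have h₃ : p ^ K * m = p ^ K * (z / p ^ K) + p ^ K := by rw [hm]; ring
  exact ⟨p ^ K * m + Y (c m), by linarith, by linarith,
    by rw [hL₀ _ K (hK' _).2, hY _ m rfl]⟩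

/-! ### Density of integers avoiding a digit -/

/-- The number of `n < N` none of whose base-`g` digits equals `z`. -/
noncomputable def countAvoiding (g z N : ℕ) : ℕ :=
  Set.ncard {n : ℕ | n < N ∧ ∀ i, n / g ^ i % g ≠ z}

lemma countAvoiding_mono (g z : ℕ) : Monotone (countAvoiding g z) := fun _ N h =>
  Set.ncard_le_ncard (fun _ hn => ⟨hn.1.trans_le h, hn.2⟩)
    ((Set.finite_lt_nat N).subset fun _ hn => hn.1)

lemma countAvoiding_le (g z N : ℕ) : countAvoiding g z N ≤ N := by
  refine (Set.ncard_le_ncard (t := Set.Iio N) (fun n hn => hn.1) (Set.finite_Iio N)).trans ?_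
  rw [← Finset.coe_Iio, Set.ncard_coe_finset, Nat.card_Iio]

/-- Splitting off the last digit leaves g - 1 choices for it and an avoiding quotient below N. -/
lemma countAvoiding_mul_le {g z : ℕ} (hz : z < g) (N : ℕ) :
    countAvoiding g z (g * N) ≤ (g - 1) * countAvoiding g z N := by
  have hg : 0 < g := by omega
  set A : Set ℕ := {n : ℕ | n < N ∧ ∀ i, n / g ^ i % g ≠ z} with hA
  have hAf : A.Finite := (Set.finite_lt_nat N).subset fun _ hn => hn.1
  set D : Finset ℕ := (Finset.range g).erase z
  have hD : D.card = g - 1 := by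
    rw [Finset.card_erase_of_mem (Finset.mem_range.2 hz), Finset.card_range]
  have hcard : ((D : Set ℕ) ×ˢ A).ncard = (g - 1) * countAvoiding g z N := by
    rw [Set.ncard_prod, Set.ncard_coe_finset, hD]
    rfl
  rw [← hcard]
  refine Set.ncard_le_ncard_of_injOn (fun n => (n % g, n / g)) ?_ ?_
    ((Finset.finite_toSet D).prod hAf)
  · rintro n ⟨hn, h⟩
    refine ⟨?_, Nat.div_lt_of_lt_mul hn, fun i => ?_⟩
    · simpa [D, Nat.mod_lt n hg] using h 0
    · have := h (i + 1)
      rwa [pow_succ', ← Nat.div_div_eq_div_mul] at this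
  · intro m _ n _ hmn
    simp only [Prod.mk.injEq] at hmn
    rw [← Nat.div_add_mod m g, ← Nat.div_add_mod n g, hmn.1, hmn.2]

lemma countAvoiding_pow_mul_le {g z : ℕ} (hz : z < g) (K N : ℕ) :
    countAvoiding g z (g ^ K * N) ≤ (g - 1) ^ K * N := by
  induction K with
  | zero => simpa using countAvoiding_le g z N
  | succ K ih =>
    rw [pow_succ', mul_assoc, pow_succ', mul_assoc]
    exact (countAvoiding_mul_le hz _).trans (Nat.mul_le_mul_left _ ih)

/-- The integers avoiding a given digit have density zero. -/
lemma tendsto_countAvoiding_div {g z : ℕ} (hz : z < g) :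
    Filter.Tendsto (fun N : ℕ => (countAvoiding g z N : ℝ) / N) Filter.atTop (nhds 0) := by
  have hg : 0 < g := by omega
  have hgR : (0 : ℝ) < g := by exact_mod_cast hg
  set ρ : ℝ := ((g - 1 : ℕ) : ℝ) / g with hρ
  have hρ0 : 0 ≤ ρ := by positivity
  have hρ1 : ρ < 1 := by
    rw [hρ, div_lt_one hgR]
    exact_mod_cast Nat.sub_lt hg one_pos
  have hbound : ∀ K N : ℕ, 0 < N →
      (countAvoiding g z N : ℝ) / N ≤ ρ ^ K + ((g - 1 : ℕ) : ℝ) ^ K / N := by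
    intro K N hN
    have hNR : (0 : ℝ) < N := by exact_mod_cast hN
    have hpos : 0 < g ^ K := by positivity
    -- Round N up to a multiple of g^K and strip K digits.
    have h₁ : countAvoiding g z N ≤ (g - 1) ^ K * (N / g ^ K + 1) := by
      refine (countAvoiding_mono g z ?_).trans (countAvoiding_pow_mul_le hz K (N / g ^ K + 1))
      rw [mul_add, mul_one]
      exact (Nat.lt_div_mul_add hpos (a := N)).le.trans (by rw [mul_comm])
    have h₂ : ((N / g ^ K : ℕ) : ℝ) ≤ (N : ℝ) / (g : ℝ) ^ K := by
      exact_mod_cast Nat.cast_div_le (α := ℝ) (m := N) (n := g ^ K)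
    have h₃ : (countAvoiding g z N : ℝ) ≤
        ((g - 1 : ℕ) : ℝ) ^ K * ((N : ℝ) / (g : ℝ) ^ K + 1) :=
      calc (countAvoiding g z N : ℝ) ≤ ((g - 1 : ℕ) : ℝ) ^ K * ((N / g ^ K : ℕ) + 1) := by
            exact_mod_cast h₁
        _ ≤ _ := by gcongr
    calc (countAvoiding g z N : ℝ) / N
        ≤ ((g - 1 : ℕ) : ℝ) ^ K * ((N : ℝ) / (g : ℝ) ^ K + 1) / N := by gcongr
      _ = _ := by rw [hρ, div_pow]; field_simp
  rw [Metric.tendsto_atTop]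
  intro ε hε
  obtain ⟨K, hK⟩ := exists_pow_lt_of_lt_one (half_pos hε) hρ1
  have hlim := (tendsto_const_div_atTop_nhds_zero_nat (((g - 1 : ℕ) : ℝ) ^ K)).eventually
    (gt_mem_nhds (half_pos hε))
  obtain ⟨N₀, hN₀⟩ := Filter.eventually_atTop.1 hlim
  refine ⟨max N₀ 1, fun N hN => ?_⟩
  have h₁ := hN₀ N (le_of_max_le_left hN)
  have h₂ := hbound K N (le_of_max_le_right hN)
  rw [Real.dist_eq, sub_zero, abs_of_nonneg (by positivity)]
  linarith

lemma hasFrequency_one_of_digit {X : Type*} {b : ℕ → X} {x : X} {g z : ℕ} (hz : z < g)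
    (h : ∀ n i, n / g ^ i % g = z → b n = x) : HasFrequency b x 1 := by
  have hlim := (tendsto_countAvoiding_div hz).const_sub 1
  rw [sub_zero] at hlim
  refine tendsto_of_tendsto_of_tendsto_of_le_of_le' hlim tendsto_const_nhds ?_ ?_
  · filter_upwards [Filter.eventually_gt_atTop 0] with N hN
    have hNR : (0 : ℝ) < N := by exact_mod_cast hN
    rw [sub_le_iff_le_add, ← add_div, le_div_iff₀ hNR, one_mul]
    have hcover : Set.Iio N ⊆ {n : ℕ | n < N ∧ b n = x} ∪
        {n : ℕ | n < N ∧ ∀ i, n / g ^ i % g ≠ z} := by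
      intro n hn
      by_cases hb : ∃ i, n / g ^ i % g = z
      · obtain ⟨i, hi⟩ := hb
        exact Or.inl ⟨hn, h n i hi⟩
      · exact Or.inr ⟨hn, fun i hi => hb ⟨i, hi⟩⟩
    have h₁ := (Set.ncard_le_ncard hcover (((Set.finite_lt_nat N).subset fun _ hn => hn.1).union
      ((Set.finite_lt_nat N).subset fun _ hn => hn.1))).trans (Set.ncard_union_le _ _)
    rw [← Finset.coe_Iio, Set.ncard_coe_finset, Nat.card_Iio] at h₁
    exact_mod_cast h₁
  · refine Filter.Eventually.of_forall fun N => div_le_one_of_le₀ ?_ (by positivity)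
    have h₁ := Set.ncard_le_ncard (s := {n : ℕ | n < N ∧ b n = x}) (t := Set.Iio N)
      (fun n hn => hn.1) (Set.finite_Iio N)
    rw [← Finset.coe_Iio, Set.ncard_coe_finset, Nat.card_Iio] at h₁
    exact_mod_cast h₁

/-! ### Linear recurrence against frequency one -/

/-- A linearly recurrent sequence in which some value has frequency one is constant. -/
lemma IsLinearlyRecurrent.eq_of_hasFrequency_one {X : Type*} {b : ℕ → X} {x : X}
    (hb : IsLinearlyRecurrent b) (hx : HasFrequency b x 1) (n : ℕ) : b n = x := by
  by_contra hne
  obtain ⟨C, hC⟩ := hb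
  have hrec : ∀ m, b m = b n → ∃ j, 1 ≤ j ∧ j ≤ C ∧ b (m + j) = b n := by
    intro m hm
    obtain ⟨j, h₁, h₂, h₃⟩ := hC [b n] (by simp) m (by
      intro t ht
      obtain rfl : t = 0 := by simpa using ht
      simpa using hm)
    exact ⟨j, h₁, by simpa using h₂, by simpa using h₃ 0 (by simp)⟩
  have hC0 : 0 < C := by
    obtain ⟨j, h₁, h₂, -⟩ := hrec n rfl
    omega
  have hstep : ∀ K, K ≤ Set.ncard {m : ℕ | m < n + C * K ∧ b m ≠ x} := by
    have hex : ∀ K : ℕ, ∃ s : Finset ℕ, ∃ m, K ≤ s.card ∧ (∀ u ∈ s, u < m ∧ b u ≠ x) ∧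
        m ≤ n + C * K ∧ b m = b n := by
      intro K
      induction K with
      | zero => exact ⟨∅, n, by simp⟩
      | succ K ih =>
        obtain ⟨s, m, h₁, h₂, h₃, h₄⟩ := ih
        obtain ⟨j, hj₁, hj₂, hj₃⟩ := hrec m h₄
        refine ⟨insert m s, m + j, ?_, ?_, by rw [mul_add]; omega, hj₃⟩
        · rw [Finset.card_insert_of_notMem fun h => lt_irrefl _ (h₂ m h).1]
          omega
        · intro u hu
          rcases Finset.mem_insert.1 hu with rfl | hu
          · exact ⟨by omega, by rwa [h₄]⟩
          · exact ⟨by have := (h₂ u hu).1; omega, (h₂ u hu).2⟩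
    intro K
    obtain ⟨s, m, h₁, h₂, h₃, -⟩ := hex K
    rw [← Set.ncard_coe_finset] at h₁
    exact h₁.trans (Set.ncard_le_ncard (fun u hu => ⟨by have := (h₂ u hu).1; omega, (h₂ u hu).2⟩)
      ((Set.finite_lt_nat _).subset fun _ hn => hn.1))
  have hsum : ∀ K, Set.ncard {m : ℕ | m < n + C * K ∧ b m = x} + K ≤ n + C * K := by
    intro K
    have hdisj : Disjoint {m : ℕ | m < n + C * K ∧ b m = x} {m : ℕ | m < n + C * K ∧ b m ≠ x} :=
      Set.disjoint_left.2 fun m h₁ h₂ => h₂.2 h₁.2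
    have h₁ := Set.ncard_union_eq hdisj ((Set.finite_lt_nat _).subset fun _ hn => hn.1)
      ((Set.finite_lt_nat _).subset fun _ hn => hn.1)
    have h₂ := Set.ncard_le_ncard (s := {m : ℕ | m < n + C * K ∧ b m = x} ∪
      {m : ℕ | m < n + C * K ∧ b m ≠ x}) (t := Set.Iio (n + C * K))
      (by rintro m (h | h) <;> exact h.1) (Set.finite_Iio _)
    rw [← Finset.coe_Iio, Set.ncard_coe_finset, Nat.card_Iio] at h₂
    have := hstep K
    omega
  have hCR : (0 : ℝ) < C := by exact_mod_cast hC0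
  -- Taking K + n returns instead of K absorbs the initial offset n: the values other than x then
  -- have proportion at least 1/(C + 1).
  have hmono : Filter.Tendsto (fun K : ℕ => n + C * (K + n)) Filter.atTop Filter.atTop :=
    Filter.tendsto_atTop_mono (fun K => (Nat.le_add_right K n).trans
      ((Nat.le_mul_of_pos_left _ hC0).trans (Nat.le_add_left _ _))) Filter.tendsto_id
  have hlim := hx.comp hmono
  have hle : (1 : ℝ) ≤ 1 - 1 / (C + 1) := by
    refine le_of_tendsto hlim (Filter.eventually_gt_atTop 0 |>.mono fun K hK => ?_)
    have h₁ := hsum (K + n)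
    have h₂ : (0 : ℝ) < ((n + C * (K + n) : ℕ) : ℝ) := by
      exact_mod_cast by positivity
    simp only [Function.comp_apply]
    rw [div_le_iff₀ h₂]
    have h₃ : ((Set.ncard {m : ℕ | m < n + C * (K + n) ∧ b m = x} : ℕ) : ℝ) + (K + n) ≤
        ((n + C * (K + n) : ℕ) : ℝ) := by exact_mod_cast h₁
    have h₄ : 1 / ((C : ℝ) + 1) * ((n + C * (K + n) : ℕ) : ℝ) ≤ K + n := by
      rw [one_div, inv_mul_le_iff₀ (by positivity)]
      push_cast
      nlinarith [(Nat.cast_nonneg K : (0 : ℝ) ≤ K)]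
    linarith
  have : (0 : ℝ) < 1 / (C + 1) := by positivity
  linarith

/-! ### Application to the combined sequence -/

section States

variable {r l p a : ℕ} {X : Type*} {P : IntLaurent r} {Q : Fin l → IntLaurent r} {k : Fin l → ℕ}

/-- A cube large enough for all the products governing the blocks of `combinedSeq`. -/
lemma exists_box (hp : p.Prime) (T : ℕ) (P : IntLaurent r) (Q : Fin l → IntLaurent r)
    (k : Fin l → ℕ) :
    ∃ B, ∀ s t i, t < T * p ^ s → SupportedIn (P ^ t * (P ^ k i * Q i)) (p ^ s * B) := by
  obtain ⟨D, hD⟩ := exists_supportedIn P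
  choose E hE using fun i => exists_supportedIn (P ^ k i * Q i)
  refine ⟨T * D + Finset.univ.sup E, fun s t i ht => ((hD.pow t).mul (hE i)).mono ?_⟩
  have h₁ : E i ≤ Finset.univ.sup E := Finset.le_sup (Finset.mem_univ i)
  calc t * D + E i ≤ T * p ^ s * D + p ^ s * Finset.univ.sup E :=
        add_le_add (Nat.mul_le_mul_right _ ht.le)
          (h₁.trans (Nat.le_mul_of_pos_left _ (pow_pos hp.pos s)))
    _ = p ^ s * (T * D + Finset.univ.sup E) := by ring

lemma combinedSeq_block {B : ℕ} (hp : p.Prime) (ha : 1 ≤ a) (F : (Fin l → ZMod (p ^ a)) → X)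
    {s t q : ℕ} (hB : ∀ i, SupportedIn (P ^ t * (P ^ k i * Q i)) (p ^ s * B)) {f : IntLaurent r}
    (h : boxResidues (p ^ a) B (P ^ (p ^ (a - 1) * q)) = boxResidues (p ^ a) B f) :
    combinedSeq F P Q k (p ^ (a - 1) * p ^ s * q + t) =
      F fun i => (constTerm (dilate (p ^ s) f * (P ^ t * (P ^ k i * Q i))) : ZMod (p ^ a)) := by
  unfold combinedSeq
  congr 1
  funext i
  rw [pow_add _ _ (k i), mul_assoc]
  exact constTerm_pow_mul_congr hp ha (hB i) h

lemma exists_boxResidues_pow (hp : p.Prime) (ha : 1 ≤ a) (P : IntLaurent r) (B x : ℕ) :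
    ∃ L₀, ∀ L, L₀ ≤ L → ∀ m,
      boxResidues (p ^ a) B (P ^ (p ^ (a - 1) * (p ^ L * m + x))) =
        (constTerm (P ^ (p ^ (a - 1) * m)) : ZMod (p ^ a)) •
          boxResidues (p ^ a) B (P ^ (p ^ (a - 1) * x)) := by
  obtain ⟨D, hD⟩ := exists_supportedIn (P ^ (p ^ (a - 1) * x))
  exact ⟨B + D + 1, fun L hL m => boxResidues_pow hp ha hD
    (Nat.lt_of_succ_le hL |>.trans (Nat.lt_pow_self hp.one_lt))⟩

/-- The constant term is the state in the cube of radius 0. -/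
lemma exists_constTerm_pow (hp : p.Prime) (ha : 1 ≤ a) (P : IntLaurent r) (x : ℕ) :
    ∃ L₀, ∀ L, L₀ ≤ L → ∀ m,
      (constTerm (P ^ (p ^ (a - 1) * (p ^ L * m + x))) : ZMod (p ^ a)) =
        constTerm (P ^ (p ^ (a - 1) * m)) * constTerm (P ^ (p ^ (a - 1) * x)) := by
  obtain ⟨L₀, hL₀⟩ := exists_boxResidues_pow hp ha P 0 x
  exact ⟨L₀, fun L hL m => congrFun (hL₀ L hL m) ⟨0, by simp⟩⟩

lemma constTerm_one : constTerm (1 : IntLaurent r) = 1 := by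
  simp [constTerm]

lemma isLinearlyRecurrent_combinedSeq (hp : p.Prime) (ha : 1 ≤ a)
    (F : (Fin l → ZMod (p ^ a)) → X) (h : ∀ n : ℕ, ¬ (p : ℤ) ∣ constTerm (P ^ n)) :
    IsLinearlyRecurrent (combinedSeq F P Q k) := by
  have : NeZero (p ^ a) := ⟨pow_ne_zero _ hp.ne_zero⟩
  obtain ⟨B, hB⟩ := exists_box hp (p ^ (a - 1)) P Q k
  set v := fun q => boxResidues (p ^ a) B (P ^ (p ^ (a - 1) * q))
  have hunit : ∀ n, IsUnit (constTerm (P ^ n) : ZMod (p ^ a)) := by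
    intro n
    rw [ZMod.coe_int_isUnit_iff_isCoprime, Nat.cast_pow]
    exact IsCoprime.pow_left (((Nat.prime_iff_prime_int.1 hp).coprime_iff_not_dvd).2 (h n))
  refine isLinearlyRecurrent_of_states (v := v) hp.one_lt (pow_pos hp.pos (a - 1))
    (fun q q' s t ht hq => ?_) ?_
  · rw [combinedSeq_block hp ha F (fun i => hB s t i ht) hq,
      combinedSeq_block hp ha F (fun i => hB s t i ht) rfl]
  · obtain ⟨G, hG⟩ := exists_gap_eq_one
      (c := fun q => (constTerm (P ^ (p ^ (a - 1) * q)) : ZMod (p ^ a))) hp.one_lt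
      (by simp [constTerm_one]) (fun n => hunit _) (exists_constTerm_pow hp ha P)
    have := exists_uniform_gap (f := fun q => (v q, v (q + 1))) fun x => ?_
    · simpa only [Prod.mk.injEq] using this
    obtain ⟨L₁, hL₁⟩ := exists_boxResidues_pow hp ha P B x
    obtain ⟨L₂, hL₂⟩ := exists_boxResidues_pow hp ha P B (x + 1)
    set L := max L₁ L₂
    have hpos : 0 < p ^ L := pow_pos hp.pos L
    -- When c q = 1, the states of x and x + 1 both reappear, at p^L q + x and p^L q + x + 1.
    refine ⟨p ^ L * G + x, fun z => ?_⟩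
    obtain ⟨q, hq₁, hq₂, hq₃⟩ := hG (z / p ^ L)
    have h₁ := hL₁ L (le_max_left _ _) q
    have h₂ := hL₂ L (le_max_right _ _) q
    rw [hq₃, one_smul] at h₁ h₂
    refine ⟨p ^ L * q + x, ?_, ?_, Prod.ext h₁ h₂⟩
    · have := (Nat.div_lt_iff_lt_mul hpos).1 hq₁
      linarith
    · have h₃ := Nat.mul_le_mul_left (p ^ L) hq₂
      have h₄ := Nat.mul_div_le z (p ^ L)
      linarith

lemma hasFrequency_combinedSeq (hp : p.Prime) (ha : 1 ≤ a) (F : (Fin l → ZMod (p ^ a)) → X)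
    (h : ∃ n : ℕ, (p : ℤ) ∣ constTerm (P ^ n)) : HasFrequency (combinedSeq F P Q k) (F 0) 1 := by
  obtain ⟨n₀, hn₀⟩ := h
  obtain ⟨B, hB⟩ := exists_box hp (p ^ (a - 1)) P Q k
  -- Since p divides c(n₀), its a-th power vanishes mod p^a.
  obtain ⟨y, hy⟩ := exists_eq_pow_of_mul
    (c := fun q => (constTerm (P ^ (p ^ (a - 1) * q)) : ZMod (p ^ a)))
    (by simp [constTerm_one]) (exists_constTerm_pow hp ha P) n₀ a
  have hy0 : (constTerm (P ^ (p ^ (a - 1) * y)) : ZMod (p ^ a)) = 0 := by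
    rw [hy, ← Int.cast_pow, ZMod.intCast_zmod_eq_zero_iff_dvd, Nat.cast_pow]
    exact pow_dvd_pow_of_dvd (prime_dvd_constTerm_pow hp hn₀) a
  -- Appending L₁ zero digits makes the whole state a multiple of the constant term, so c(y) = 0
  -- kills every coefficient in the cube.
  obtain ⟨L₁, hL₁⟩ := exists_boxResidues_pow hp ha P B 0
  obtain ⟨L₂, hL₂⟩ := exists_constTerm_pow hp ha P y
  obtain ⟨L₃, hL₃⟩ : ∃ L, y < p ^ L := ⟨y, Nat.lt_pow_self hp.one_lt⟩
  set L := max L₂ L₃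
  have hyL : y < p ^ L := hL₃.trans_le (Nat.pow_le_pow_right hp.pos (le_max_right _ _))
  have hzero : ∀ m, boxResidues (p ^ a) B (P ^ (p ^ (a - 1) * (p ^ L₁ * (p ^ L * m + y)))) =
      boxResidues (p ^ a) B (0 : IntLaurent r) := by
    intro m
    have h₁ := hL₁ L₁ le_rfl (p ^ L * m + y)
    rw [hL₂ L (le_max_left _ _), hy0, mul_zero, zero_smul, add_zero] at h₁
    rw [h₁]
    funext e
    simp [boxResidues]
  -- This is the forcing digit in base p^(a-1+L₁+L): digits m above it give p^(a-1) p^L₁ (p^L m +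
  -- y), whose state is zero.
  set z := p ^ (a - 1) * (p ^ L₁ * y)
  have hg : p ^ (a - 1 + L₁ + L) = p ^ (a - 1) * (p ^ L₁ * p ^ L) := by ring
  have hz : z < p ^ (a - 1 + L₁ + L) := by
    rw [hg]
    exact Nat.mul_lt_mul_of_pos_left (Nat.mul_lt_mul_of_pos_left hyL (pow_pos hp.pos _))
      (pow_pos hp.pos _)
  refine hasFrequency_one_of_digit hz fun n i hn => ?_
  rw [← pow_mul] at hn
  set s := (a - 1 + L₁ + L) * i
  have hs : 0 < p ^ s := pow_pos hp.pos s
  set m := n / p ^ s / p ^ (a - 1 + L₁ + L) with hm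
  have hdecomp : n = p ^ (a - 1) * p ^ s * (p ^ L₁ * (p ^ L * m + y)) + n % p ^ s := by
    have h₁ := Nat.div_add_mod n (p ^ s)
    have h₂ := Nat.div_add_mod (n / p ^ s) (p ^ (a - 1 + L₁ + L))
    rw [hn, ← hm] at h₂
    calc n = p ^ s * (n / p ^ s) + n % p ^ s := h₁.symm
      _ = p ^ s * (p ^ (a - 1 + L₁ + L) * m + z) + n % p ^ s := by rw [h₂]
      _ = _ := by rw [hg]; ring
  have ht : n % p ^ s < p ^ (a - 1) * p ^ s :=
    (Nat.mod_lt n hs).trans_le (Nat.le_mul_of_pos_left _ (pow_pos hp.pos _))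
  rw [hdecomp, combinedSeq_block hp ha F (fun i => hB s _ i ht) (hzero m)]
  congr 1
  funext i
  simp [constTerm]

end States

theorem mainTheorem2 {r l p a : ℕ} (hp : p.Prime) (ha : 1 ≤ a) {X : Type*}
    (F : (Fin l → ZMod (p ^ a)) → X) (P : IntLaurent r) (Q : Fin l → IntLaurent r)
    (k : Fin l → ℕ) :
    (IsLinearlyRecurrent (combinedSeq F P Q k) ↔
      (∀ n : ℕ, ¬ (p : ℤ) ∣ constTerm (P ^ n)) ∨ ∀ n : ℕ, combinedSeq F P Q k n = F 0) ∧
    ((∃ n : ℕ, (p : ℤ) ∣ constTerm (P ^ n)) → HasFrequency (combinedSeq F P Q k) (F 0) 1) := by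
  refine ⟨⟨fun h => ?_, ?_⟩, hasFrequency_combinedSeq hp ha F⟩
  · by_cases hn : ∀ n : ℕ, ¬ (p : ℤ) ∣ constTerm (P ^ n)
    · exact Or.inl hn
    · push Not at hn
      exact Or.inr (h.eq_of_hasFrequency_one (hasFrequency_combinedSeq hp ha F hn))
  · rintro (h | h)
    · exact isLinearlyRecurrent_combinedSeq hp ha F h
    · refine ⟨1, fun w hw i hi => ⟨1, le_rfl, ?_, fun t ht => ?_⟩⟩
      · rw [one_mul]
        exact List.length_pos_iff.2 hw
      · rw [h, ← h (i + t), hi t ht]
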